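/- Let $N>2$, let $\Omega\subset\mathbb{R}^N$ be bounded and open, and let $M:\Omega\to\mathbb{R}^{N\times N}$ be a measurable matrix field such that, for some $\alpha,\beta>0$, $$\alpha|\xi|^2\le M(x)\xi\cdot\xi\le\beta|\xi|^2\qquad\text{for a.e. }x\in\Omega\text{ and all }\xi\in\mathbb{R}^N .$$ Let $h\in W^{1,\infty}_{loc}(\mathbb{R})$ (that is, $h:\mathbb{R}\to\mathbb{R}$ is locally Lipschitz) with $h(0)=0$ and $\lim_{|s|\to\infty}|h(s)|/|s|=+\infty$. Let $\mu\ge 0$, $f\in L^{\frac{2N}{N+2}}(\Omega)$ and $E\in[L^2(\Omega)]^N$. A function $v\in W^{1,2}_0(\Omega)$ is called a weak subsolution of $$-\mathrm{div}(M\nabla u)+\mu u=-\mathrm{div}(h(u)E)+f\ \text{ in }\Omega,\qquad u=0\ \text{ on }\partial\Omega,\tag{P}$$ if for every $\phi\in W^{1,2}_0(\Omega)\cap L^\infty(\Omega)$ with $\phi\ge0$ a.e. the functions $M\nabla v\cdot\nabla\phi$ and $h(v)E\cdot\nabla\phi$ are integrable on $\Omega$ and $$\int_\Omega M\nabla v\cdot\nabla\phi+\int_\Omega\mu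 v\phi\le\int_\Omega h(v)E\cdot\nabla\phi+\int_\Omega f\phi .$$ A weak supersolution is defined in the same way with the reversed inequality. (The integrability of $M\nabla v\cdot\nabla\phi$ is automatic if $M$ is bounded, and that of $h(v)E\cdot\nabla\phi$ if $v$ is bounded.) A weak solution of (P) is a function $u\in W^{1,2}_0(\Omega)$ with $h(u)E\in[L^2(\Omega)]^N$ such that, for every $\phi\in W^{1,2}_0(\Omega)$, $M\nabla u\cdot\nabla\phi$ is integrable on $\Omega$ and $\int_\Omega M\nabla u\cdot\nabla\phi+\int_\Omega\mu u\phi=\int_\Omega h(u)E\cdot\nabla\phi+\int_\Omega f\phi$. **Theorem.** 1. If $v,w\in W^{1,2}_0(\Omega)\cap L^\infty(\Omega)$ are a weak subsolution and a weak supersolution of (P), respectively, then $v\le w$ a.e. in $\Omega$. 2. Suppose that for some $\theta>0$ and $c\in\mathbb{R}$ one has $|h'(s)|\le c(|s|^\theta+1)$ for a.e. $s\in\mathbb{R}$. If $v,w\in W^{1,2}_0(\Omega)$ (possibly unbounded) are a weak subsolution and a weak supersolution of (P), respectively, and $|v|^\theta|E|+|w|^\theta|E|\in L^2(\Omega)$,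 then $v\le w$ a.e. in $\Omega$. 3. Consequently, two weak solutions $u_1,u_2$ of (P) coincide a.e. in $\Omega$ if both are bounded, or if $|h'(s)|\le c(|s|^\theta+1)$ for a.e. $s\in\mathbb{R}$ and $|u_1|^\theta|E|+|u_2|^\theta|E|\in L^2(\Omega)$ for some $\theta>0$ and $c\in\mathbb{R}$. -/

import Mathlib

open MeasureTheory Filter Topology
open scoped ContDiff ENNReal RealInnerProductSpace

namespace DriftComparison

/-- `ψ ∈ C_c^∞(Ω)`. -/
def IsTestFunction {N : ℕ} (Ω : Set (EuclideanSpace ℝ (Fin N)))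
    (ψ : EuclideanSpace ℝ (Fin N) → ℝ) : Prop :=
  ContDiff ℝ ∞ ψ ∧ HasCompactSupport ψ ∧ tsupport ψ ⊆ Ω

/-- `Du` is the weak (distributional) gradient of `u` on the open set `Ω`. -/
structure HasWeakGradient {N : ℕ} (Ω : Set (EuclideanSpace ℝ (Fin N)))
    (u : EuclideanSpace ℝ (Fin N) → ℝ)
    (Du : EuclideanSpace ℝ (Fin N) → EuclideanSpace ℝ (Fin N)) : Prop where
  locallyIntegrable : LocallyIntegrableOn u Ω
  locallyIntegrable_grad : LocallyIntegrableOn Du Ω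
  integral_eq : ∀ ψ : EuclideanSpace ℝ (Fin N) → ℝ, IsTestFunction Ω ψ →
    ∫ x in Ω, u x • gradient ψ x = - ∫ x in Ω, ψ x • Du x

/-- `u ∈ W^{1,2}(Ω)` with weak gradient `Du`. -/
structure MemW12 {N : ℕ} (Ω : Set (EuclideanSpace ℝ (Fin N)))
    (u : EuclideanSpace ℝ (Fin N) → ℝ)
    (Du : EuclideanSpace ℝ (Fin N) → EuclideanSpace ℝ (Fin N)) : Prop where
  memLp : MemLp u 2 (volume.restrict Ω)
  memLp_grad : MemLp Du 2 (volume.restrict Ω)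
  weakGradient : HasWeakGradient Ω u Du

/-- `u ∈ W^{1,2}_0(Ω)` with weak gradient `Du`: `u` belongs to `W^{1,2}(Ω)` and is the limit of
functions of `C_c^∞(Ω)` in the norm of `W^{1,2}(Ω)`. -/
structure MemW12Zero {N : ℕ} (Ω : Set (EuclideanSpace ℝ (Fin N)))
    (u : EuclideanSpace ℝ (Fin N) → ℝ)
    (Du : EuclideanSpace ℝ (Fin N) → EuclideanSpace ℝ (Fin N)) : Prop where
  memW12 : MemW12 Ω u Du
  exists_approx : ∃ ψ : ℕ → EuclideanSpace ℝ (Fin N) → ℝ,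
    (∀ n, IsTestFunction Ω (ψ n)) ∧
    Tendsto (fun n => eLpNorm (fun x => ψ n x - u x) 2 (volume.restrict Ω)) atTop (𝓝 0) ∧
    Tendsto (fun n => eLpNorm (fun x => gradient (ψ n) x - Du x) 2 (volume.restrict Ω))
      atTop (𝓝 0)

/-- `M` is measurable on `Ω` and `α |ξ|² ≤ M(x) ξ · ξ ≤ β |ξ|²` for a.e. `x ∈ Ω` and all `ξ`.
Symmetry is not required. -/
structure IsElliptic {N : ℕ} (Ω : Set (EuclideanSpace ℝ (Fin N)))
    (M : EuclideanSpace ℝ (Fin N) → Matrix (Fin N) (Fin N) ℝ) (α β : ℝ) : Prop where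
  measurable : ∀ i j, AEMeasurable (fun x => M x i j) (volume.restrict Ω)
  bounds : ∀ᵐ x ∂(volume.restrict Ω), ∀ ξ : EuclideanSpace ℝ (Fin N),
    α * ‖ξ‖ ^ 2 ≤ ⟪(M x).toEuclideanLin ξ, ξ⟫ ∧ ⟪(M x).toEuclideanLin ξ, ξ⟫ ≤ β * ‖ξ‖ ^ 2

/-- The standing assumptions on the nonlinearity. For a function with pointwise values on the real
line, membership in `W^{1,∞}_loc(ℝ)` (for the continuous representative) is local Lipschitz
continuity. -/
structure IsAdmissibleNonlinearity (h : ℝ → ℝ) : Prop where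
  locallyLipschitz : LocallyLipschitz h
  map_zero : h 0 = 0
  superlinear : Tendsto (fun s => |h s| / |s|) (cocompact ℝ) atTop

/-- `v ∈ W^{1,2}_0(Ω)` satisfies `-div(M∇v) + μ v ≤ -div(h(v)E) + f` in the weak sense: against
every nonnegative test function in `W^{1,2}_0(Ω) ∩ L^∞(Ω)`. The two integrability clauses say that
the integrals in the inequality make sense; the first is automatic if `M` is bounded, the second
if `h(v)E ∈ L²`. -/
def IsWeakSubsolution {N : ℕ} (Ω : Set (EuclideanSpace ℝ (Fin N)))
    (M : EuclideanSpace ℝ (Fin N) → Matrix (Fin N) (Fin N) ℝ) (μ : ℝ) (h : ℝ → ℝ)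
    (E : EuclideanSpace ℝ (Fin N) → EuclideanSpace ℝ (Fin N))
    (f v : EuclideanSpace ℝ (Fin N) → ℝ) : Prop :=
  ∃ Dv, MemW12Zero Ω v Dv ∧ ∀ φ Dφ, MemW12Zero Ω φ Dφ → MemLp φ ∞ (volume.restrict Ω) →
    (∀ᵐ x ∂(volume.restrict Ω), 0 ≤ φ x) →
    IntegrableOn (fun x => ⟪(M x).toEuclideanLin (Dv x), Dφ x⟫) Ω ∧
    IntegrableOn (fun x => ⟪h (v x) • E x, Dφ x⟫) Ω ∧
    (∫ x in Ω, ⟪(M x).toEuclideanLin (Dv x), Dφ x⟫) + ∫ x in Ω, μ * v x * φ x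
      ≤ (∫ x in Ω, ⟪h (v x) • E x, Dφ x⟫) + ∫ x in Ω, f x * φ x

/-- `w ∈ W^{1,2}_0(Ω)` satisfies `-div(M∇w) + μ w ≥ -div(h(w)E) + f` in the weak sense. -/
def IsWeakSupersolution {N : ℕ} (Ω : Set (EuclideanSpace ℝ (Fin N)))
    (M : EuclideanSpace ℝ (Fin N) → Matrix (Fin N) (Fin N) ℝ) (μ : ℝ) (h : ℝ → ℝ)
    (E : EuclideanSpace ℝ (Fin N) → EuclideanSpace ℝ (Fin N))
    (f w : EuclideanSpace ℝ (Fin N) → ℝ) : Prop :=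
  ∃ Dw, MemW12Zero Ω w Dw ∧ ∀ φ Dφ, MemW12Zero Ω φ Dφ → MemLp φ ∞ (volume.restrict Ω) →
    (∀ᵐ x ∂(volume.restrict Ω), 0 ≤ φ x) →
    IntegrableOn (fun x => ⟪(M x).toEuclideanLin (Dw x), Dφ x⟫) Ω ∧
    IntegrableOn (fun x => ⟪h (w x) • E x, Dφ x⟫) Ω ∧
    (∫ x in Ω, ⟪h (w x) • E x, Dφ x⟫) + ∫ x in Ω, f x * φ x
      ≤ (∫ x in Ω, ⟪(M x).toEuclideanLin (Dw x), Dφ x⟫) + ∫ x in Ω, μ * w x * φ x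

/-- `u ∈ W^{1,2}_0(Ω)`, with `h(u)E ∈ L²(Ω)`, is a weak solution of
`-div(M∇u) + μ u = -div(h(u)E) + f`, `u = 0` on the boundary. -/
def IsWeakSolution {N : ℕ} (Ω : Set (EuclideanSpace ℝ (Fin N)))
    (M : EuclideanSpace ℝ (Fin N) → Matrix (Fin N) (Fin N) ℝ) (μ : ℝ) (h : ℝ → ℝ)
    (E : EuclideanSpace ℝ (Fin N) → EuclideanSpace ℝ (Fin N))
    (f u : EuclideanSpace ℝ (Fin N) → ℝ) : Prop :=
  ∃ Du, MemW12Zero Ω u Du ∧ MemLp (fun x => h (u x) • E x) 2 (volume.restrict Ω) ∧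
    ∀ φ Dφ, MemW12Zero Ω φ Dφ →
      IntegrableOn (fun x => ⟪(M x).toEuclideanLin (Du x), Dφ x⟫) Ω ∧
      (∫ x in Ω, ⟪(M x).toEuclideanLin (Du x), Dφ x⟫) + ∫ x in Ω, μ * u x * φ x
        = (∫ x in Ω, ⟪h (u x) • E x, Dφ x⟫) + ∫ x in Ω, f x * φ x

end DriftComparison

/-! Both comparison statements reduce to one: if `|h(v) - h(w)| |E| ≤ |v - w| g` a.e. with `g ∈
L²(Ω)`, then `v ≤ w` a.e. For bounded `v, w` take `g = K |E|`, with `K` a Lipschitz constant of `h`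
on an interval containing their values. Under the growth condition on `h'`, take `g = |c| (|v|^θ +
|w|^θ + 1) |E|`.

Test both inequalities with `φ = min((v - w)⁺, ε)`, which is bounded and whose gradient lives on the
strip `{0 < v - w ≤ ε}`. After subtraction the `f` terms cancel, the `μ` term has a good sign, and
on the strip the drift difference is at most `ε g |∇φ|`. Ellipticity and Young's inequality give `∫
|∇φ|² ≤ (ε²/α²) ∫ g²` with the right integral over the strip only
(`IsWeakSubsolution.exists_energy_estimate`).

By Poincaré and Chebyshev, the factor `ε²` cancels: for `ε ≤ δ`, the measure of `{v - w ≥ δ}` is at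
most a constant times the integral of `g²` over the strip. As `ε → 0` the strips shrink to the empty
set, so this measure is zero (`IsWeakSubsolution.ae_le`).

That `φ` is an admissible test function is `MemW12Zero.truncate`, obtained from a chain rule by
approximation. Uniqueness is comparison applied in both directions. -/

namespace DriftComparison

/-! ### Calculus of test functions. -/

section TestFunctions

variable {N : ℕ} {Ω : Set (EuclideanSpace ℝ (Fin N))} {ψ η : EuclideanSpace ℝ (Fin N) → ℝ}

lemma norm_gradient (ψ : EuclideanSpace ℝ (Fin N) → ℝ) (x : EuclideanSpace ℝ (Fin N)) :
    ‖gradient ψ x‖ = ‖fderiv ℝ ψ x‖ := by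
  simp [gradient]

lemma inner_gradient (ψ : EuclideanSpace ℝ (Fin N) → ℝ) (x e : EuclideanSpace ℝ (Fin N)) :
    ⟪e, gradient ψ x⟫ = fderiv ℝ ψ x e := by
  rw [real_inner_comm]
  simp [gradient]

lemma IsTestFunction.differentiable (hψ : IsTestFunction Ω ψ) : Differentiable ℝ ψ :=
  hψ.1.differentiable (by simp)

lemma IsTestFunction.continuous_gradient (hψ : IsTestFunction Ω ψ) : Continuous (gradient ψ) :=
  (InnerProductSpace.toDual ℝ _).symm.continuous.comp (hψ.1.continuous_fderiv (by simp))

lemma IsTestFunction.hasCompactSupport_gradient (hψ : IsTestFunction Ω ψ) :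
    HasCompactSupport (gradient ψ) :=
  (hψ.2.1.fderiv ℝ).comp_left (g := (InnerProductSpace.toDual ℝ _).symm) (map_zero _)

lemma IsTestFunction.memLp (hψ : IsTestFunction Ω ψ) (p : ℝ≥0∞) :
    MemLp ψ p (volume.restrict Ω) :=
  (hψ.1.continuous.memLp_of_hasCompactSupport hψ.2.1).restrict Ω

lemma IsTestFunction.memLp_gradient (hψ : IsTestFunction Ω ψ) (p : ℝ≥0∞) :
    MemLp (gradient ψ) p (volume.restrict Ω) :=
  (hψ.continuous_gradient.memLp_of_hasCompactSupport hψ.hasCompactSupport_gradient).restrict Ω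

lemma IsTestFunction.sub (hψ : IsTestFunction Ω ψ) (hη : IsTestFunction Ω η) :
    IsTestFunction Ω (fun x => ψ x - η x) :=
  ⟨hψ.1.sub hη.1, hψ.2.1.sub hη.2.1,
    (tsupport_sub ψ η).trans (Set.union_subset hψ.2.2 hη.2.2)⟩

lemma gradient_sub_of_isTestFunction (hψ : IsTestFunction Ω ψ) (hη : IsTestFunction Ω η)
    (x : EuclideanSpace ℝ (Fin N)) :
    gradient (fun x => ψ x - η x) x = gradient ψ x - gradient η x := by
  rw [gradient, fderiv_fun_sub (hψ.differentiable x) (hη.differentiable x), map_sub]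
  rfl

lemma IsTestFunction.comp (hψ : IsTestFunction Ω ψ) {G : ℝ → ℝ} (hG : ContDiff ℝ ∞ G)
    (hG0 : G 0 = 0) : IsTestFunction Ω (fun x => G (ψ x)) :=
  ⟨hG.comp hψ.1, hψ.2.1.comp_left hG0, (tsupport_comp_subset hG0 ψ).trans hψ.2.2⟩

lemma gradient_comp_of_isTestFunction (hψ : IsTestFunction Ω ψ) {G : ℝ → ℝ}
    (hG : Differentiable ℝ G) (x : EuclideanSpace ℝ (Fin N)) :
    gradient (fun x => G (ψ x)) x = deriv G (ψ x) • gradient ψ x := by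
  have := ((hG (ψ x)).hasDerivAt.comp_hasFDerivAt x (hψ.differentiable x).hasFDerivAt).fderiv
  simp only [gradient]
  rw [← map_smul, ← this]
  rfl

/-- Supports lie in `Ω`, so both integrals extend to the whole space, where integration by parts in
each direction `e` leaves no boundary term. -/
lemma IsTestFunction.integral_smul_gradient (hψ : IsTestFunction Ω ψ) (hη : IsTestFunction Ω η) :
    ∫ x in Ω, ψ x • gradient η x = -∫ x in Ω, η x • gradient ψ x := by
  have supp : ∀ {a b : EuclideanSpace ℝ (Fin N) → ℝ}, IsTestFunction Ω a →
      ∫ x in Ω, a x • gradient b x = ∫ x, a x • gradient b x := by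
    intro a b ha
    refine setIntegral_eq_integral_of_forall_compl_eq_zero fun x hx => ?_
    rw [image_eq_zero_of_notMem_tsupport fun h => hx (ha.2.2 h), zero_smul]
  have int : ∀ {a b : EuclideanSpace ℝ (Fin N) → ℝ}, IsTestFunction Ω a → IsTestFunction Ω b →
      Integrable (fun x => a x • gradient b x) := fun ha hb =>
    (ha.1.continuous.smul hb.continuous_gradient).integrable_of_hasCompactSupport
      (hb.hasCompactSupport_gradient.smul_left)
  rw [supp hψ, supp hη]
  refine ext_inner_left ℝ fun e => ?_
  rw [inner_neg_right, ← integral_inner (int hψ hη), ← integral_inner (int hη hψ)]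
  simp only [inner_smul_right, inner_gradient]
  have h1 : Integrable (fun x => ψ x * fderiv ℝ η x e) := by
    simpa only [inner_smul_right, inner_gradient] using (int hψ hη).const_inner (𝕜 := ℝ) e
  have h2 : Integrable (fun x => η x * fderiv ℝ ψ x e) := by
    simpa only [inner_smul_right, inner_gradient] using (int hη hψ).const_inner (𝕜 := ℝ) e
  rw [integral_mul_fderiv_eq_neg_fderiv_mul_of_integrable (by simpa only [mul_comm] using h2) h1
    ((hψ.1.continuous.mul hη.1.continuous).integrable_of_hasCompactSupport hη.2.1.mul_left)
    (fun x _ => hψ.differentiable x) (fun x _ => hη.differentiable x)]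
  simp only [mul_comm]

end TestFunctions

/-! ### `W^{1,2}_0` as a closed linear space. -/

section Closure

variable {N : ℕ} {Ω : Set (EuclideanSpace ℝ (Fin N))} {u u' : EuclideanSpace ℝ (Fin N) → ℝ}
  {Du Du' : EuclideanSpace ℝ (Fin N) → EuclideanSpace ℝ (Fin N)}

lemma tendsto_integral_smul_of_tendsto_eLpNorm {X F : Type*} [MeasurableSpace X] {ν : Measure X}
    [NormedAddCommGroup F] [NormedSpace ℝ F] {a : ℕ → X → ℝ} {a₀ : X → ℝ} {b : ℕ → X → F}
    {b₀ : X → F} (ha : ∀ n, MemLp (a n) 2 ν) (ha₀ : MemLp a₀ 2 ν) (hb : ∀ n, MemLp (b n) 2 ν)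
    (hb₀ : MemLp b₀ 2 ν)
    (hta : Tendsto (fun n => eLpNorm (fun x => a n x - a₀ x) 2 ν) atTop (𝓝 0))
    (htb : Tendsto (fun n => eLpNorm (fun x => b n x - b₀ x) 2 ν) atTop (𝓝 0)) :
    Tendsto (fun n => ∫ x, a n x • b n x ∂ν) atTop (𝓝 (∫ x, a₀ x • b₀ x ∂ν)) := by
  refine tendsto_integral_of_L1' _ (hb₀.smul (r := 1) ha₀).1
    (.of_forall fun n => memLp_one_iff_integrable.1 ((hb n).smul (ha n))) ?_
  have hlim : Tendsto (fun n => eLpNorm (fun x => a n x - a₀ x) 2 ν *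
      eLpNorm (fun x => b n x - b₀ x) 2 ν + eLpNorm (fun x => a n x - a₀ x) 2 ν * eLpNorm b₀ 2 ν
      + eLpNorm a₀ 2 ν * eLpNorm (fun x => b n x - b₀ x) 2 ν) atTop (𝓝 0) := by
    have h1 := ENNReal.Tendsto.mul hta (.inr ENNReal.zero_ne_top) htb (.inr ENNReal.zero_ne_top)
    have h2 := ENNReal.Tendsto.mul_const (b := eLpNorm b₀ 2 ν) hta (.inr hb₀.2.ne)
    have h3 := ENNReal.Tendsto.const_mul (a := eLpNorm a₀ 2 ν) htb (.inr ha₀.2.ne)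
    simpa using (h1.add h2).add h3
  refine tendsto_of_tendsto_of_tendsto_of_le_of_le tendsto_const_nhds hlim
    (fun _ => zero_le) fun n => ?_
  have hda := ((ha n).sub ha₀).1
  have hdb := ((hb n).sub hb₀).1
  -- Each of the three products has a factor tending to zero in `L²`, so Hölder's inequality applies
  -- to each.
  have key : (fun x => a n x • b n x) - (fun x => a₀ x • b₀ x)
      = ((a n - a₀) • (b n - b₀) + (a n - a₀) • b₀) + a₀ • (b n - b₀) := by
    ext x
    simp only [Pi.sub_apply, Pi.add_apply, Pi.smul_apply', sub_smul, smul_sub]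
    abel
  have hm {p : X → ℝ} {q : X → F} (hp : AEStronglyMeasurable p ν)
      (hq : AEStronglyMeasurable q ν) : eLpNorm (p • q) 1 ν ≤ eLpNorm p 2 ν * eLpNorm q 2 ν :=
    eLpNorm_smul_le_mul_eLpNorm hq hp
  change eLpNorm ((fun x => a n x • b n x) - (fun x => a₀ x • b₀ x)) 1 ν ≤ _
  rw [key]
  refine (eLpNorm_add_le ((hda.smul hdb).add (hda.smul hb₀.1)) (ha₀.1.smul hdb) le_rfl).trans ?_
  refine add_le_add ((eLpNorm_add_le (hda.smul hdb) (hda.smul hb₀.1) le_rfl).trans ?_) (hm ha₀.1 hdb)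
  exact add_le_add (hm hda hdb) (hm hda hb₀.1)

/-- The weak gradient identity need not be checked separately: it holds for each `ψ n` and both
sides pass to the `L²` limit. Boundedness of `Ω` turns `L²` into `L¹` for the local integrability
clauses. -/
lemma memW12Zero_of_tendsto_isTestFunction (hΩ : Bornology.IsBounded Ω)
    (hu : MemLp u 2 (volume.restrict Ω)) (hDu : MemLp Du 2 (volume.restrict Ω))
    {ψ : ℕ → EuclideanSpace ℝ (Fin N) → ℝ} (hψ : ∀ n, IsTestFunction Ω (ψ n))
    (h₁ : Tendsto (fun n => eLpNorm (fun x => ψ n x - u x) 2 (volume.restrict Ω)) atTop (𝓝 0))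
    (h₂ : Tendsto (fun n => eLpNorm (fun x => gradient (ψ n) x - Du x) 2 (volume.restrict Ω))
      atTop (𝓝 0)) : MemW12Zero Ω u Du := by
  have : IsFiniteMeasure (volume.restrict Ω) :=
    ⟨by simpa using hΩ.measure_lt_top⟩
  refine ⟨⟨hu, hDu, ⟨?_, ?_, fun η hη => ?_⟩⟩, ψ, hψ, h₁, h₂⟩
  · exact IntegrableOn.locallyIntegrableOn (hu.integrable (by norm_num))
  · exact IntegrableOn.locallyIntegrableOn (hDu.integrable (by norm_num))
  have l1 := tendsto_integral_smul_of_tendsto_eLpNorm (fun n => (hψ n).memLp 2) hu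
    (fun _ => hη.memLp_gradient 2) (hη.memLp_gradient 2) h₁ (by simp)
  have l2 := tendsto_integral_smul_of_tendsto_eLpNorm (fun _ => hη.memLp 2) (hη.memLp 2)
    (fun n => (hψ n).memLp_gradient 2) hDu (by simp) h₂
  refine tendsto_nhds_unique l1 ?_
  simpa only [(hψ _).integral_smul_gradient hη] using l2.neg

lemma eLpNorm_sub_le_add_eLpNorm_sub {X F : Type*} [MeasurableSpace X] {ν : Measure X}
    [NormedAddCommGroup F] {a b c : X → F} (ha : AEStronglyMeasurable a ν)
    (hb : AEStronglyMeasurable b ν) (hc : AEStronglyMeasurable c ν) :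
    eLpNorm (fun x => a x - c x) 2 ν
      ≤ eLpNorm (fun x => a x - b x) 2 ν + eLpNorm (fun x => b x - c x) 2 ν := by
  have : (fun x => a x - c x) = (a - b) + (b - c) := by ext x; simp
  rw [this]
  exact eLpNorm_add_le (ha.sub hb) (hb.sub hc) (by norm_num)

/-- `W^{1,2}_0` is closed under convergence of functions and gradients in `L²`. -/
lemma MemW12Zero.of_tendsto (hΩ : Bornology.IsBounded Ω)
    (hu : MemLp u 2 (volume.restrict Ω)) (hDu : MemLp Du 2 (volume.restrict Ω))
    {a : ℕ → EuclideanSpace ℝ (Fin N) → ℝ}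
    {Da : ℕ → EuclideanSpace ℝ (Fin N) → EuclideanSpace ℝ (Fin N)}
    (ha : ∀ n, MemW12Zero Ω (a n) (Da n))
    (h₁ : Tendsto (fun n => eLpNorm (fun x => a n x - u x) 2 (volume.restrict Ω)) atTop (𝓝 0))
    (h₂ : Tendsto (fun n => eLpNorm (fun x => Da n x - Du x) 2 (volume.restrict Ω))
      atTop (𝓝 0)) : MemW12Zero Ω u Du := by
  -- Diagonal choice of test functions. At `n = 0` the tolerance is `∞`, which is harmless.
  have hex : ∀ n : ℕ, ∃ ψ, IsTestFunction Ω ψ ∧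
      eLpNorm (fun x => ψ x - a n x) 2 (volume.restrict Ω) ≤ (n : ℝ≥0∞)⁻¹ ∧
      eLpNorm (fun x => gradient ψ x - Da n x) 2 (volume.restrict Ω) ≤ (n : ℝ≥0∞)⁻¹ := by
    intro n
    obtain ⟨ψ, hψ, l1, l2⟩ := (ha n).exists_approx
    have hpos : (0 : ℝ≥0∞) < (n : ℝ≥0∞)⁻¹ := by simp
    obtain ⟨k, h1, h2⟩ := ((l1.eventually_le_const hpos).and (l2.eventually_le_const hpos)).exists
    exact ⟨ψ k, hψ k, h1, h2⟩
  choose ψ hψ b1 b2 using hex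
  refine memW12Zero_of_tendsto_isTestFunction hΩ hu hDu hψ ?_ ?_
  · refine tendsto_of_tendsto_of_tendsto_of_le_of_le tendsto_const_nhds
      (by simpa using ENNReal.tendsto_inv_nat_nhds_zero.add h₁) (fun _ => zero_le) fun n => ?_
    exact (eLpNorm_sub_le_add_eLpNorm_sub ((hψ n).memLp 2).1 (ha n).memW12.memLp.1 hu.1).trans
      (add_le_add_left (b1 n) _)
  · refine tendsto_of_tendsto_of_tendsto_of_le_of_le tendsto_const_nhds
      (by simpa using ENNReal.tendsto_inv_nat_nhds_zero.add h₂) (fun _ => zero_le) fun n => ?_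
    exact (eLpNorm_sub_le_add_eLpNorm_sub ((hψ n).memLp_gradient 2).1
      (ha n).memW12.memLp_grad.1 hDu.1).trans (add_le_add_left (b2 n) _)

lemma MemW12Zero.sub (hΩ : Bornology.IsBounded Ω) (hu : MemW12Zero Ω u Du)
    (hu' : MemW12Zero Ω u' Du') :
    MemW12Zero Ω (fun x => u x - u' x) (fun x => Du x - Du' x) := by
  obtain ⟨ψ, hψ, l1, l2⟩ := hu.exists_approx
  obtain ⟨ψ', hψ', l1', l2'⟩ := hu'.exists_approx
  refine memW12Zero_of_tendsto_isTestFunction hΩ (hu.memW12.memLp.sub hu'.memW12.memLp)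
    (hu.memW12.memLp_grad.sub hu'.memW12.memLp_grad) (fun n => (hψ n).sub (hψ' n)) ?_ ?_
  · refine tendsto_of_tendsto_of_tendsto_of_le_of_le tendsto_const_nhds
      (by simpa using l1.add l1') (fun _ => zero_le) fun n => ?_
    have : (fun x => ψ n x - ψ' n x - (u x - u' x))
        = (fun x => ψ n x - u x) - fun x => ψ' n x - u' x := by
      ext x; simp only [Pi.sub_apply]; ring
    rw [this]
    exact eLpNorm_sub_le (((hψ n).memLp 2).sub hu.memW12.memLp).1
      (((hψ' n).memLp 2).sub hu'.memW12.memLp).1 (by norm_num)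
  · refine tendsto_of_tendsto_of_tendsto_of_le_of_le tendsto_const_nhds
      (by simpa using l2.add l2') (fun _ => zero_le) fun n => ?_
    have : (fun x => gradient (fun x => ψ n x - ψ' n x) x - (Du x - Du' x))
        = (fun x => gradient (ψ n) x - Du x) - fun x => gradient (ψ' n) x - Du' x := by
      ext1 x
      simp only [Pi.sub_apply, gradient_sub_of_isTestFunction (hψ n) (hψ' n)]
      abel
    rw [this]
    exact eLpNorm_sub_le (((hψ n).memLp_gradient 2).sub hu.memW12.memLp_grad).1
      (((hψ' n).memLp_gradient 2).sub hu'.memW12.memLp_grad).1 (by norm_num)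

end Closure

/-! ### Chain rule and truncation in `W^{1,2}_0`. -/

section ChainRule

variable {N : ℕ} {Ω : Set (EuclideanSpace ℝ (Fin N))} {u : EuclideanSpace ℝ (Fin N) → ℝ}
  {Du : EuclideanSpace ℝ (Fin N) → EuclideanSpace ℝ (Fin N)}

lemma tendsto_eLpNorm_two_zero_of_dominated {X F : Type*} [MeasurableSpace X] {ν : Measure X}
    [NormedAddCommGroup F] {f : ℕ → X → F} {B : X → ℝ} (hB : MemLp B 2 ν)
    (hf : ∀ n, AEStronglyMeasurable (f n) ν) (hfB : ∀ n, ∀ᵐ x ∂ν, ‖f n x‖ ≤ B x)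
    (hlim : ∀ᵐ x ∂ν, Tendsto (fun n => f n x) atTop (𝓝 0)) :
    Tendsto (fun n => eLpNorm (f n) 2 ν) atTop (𝓝 0) := by
  have key : Tendsto (fun n => ∫⁻ x, ‖f n x‖ₑ ^ (2 : ℝ) ∂ν) atTop (𝓝 (∫⁻ _, 0 ∂ν)) := by
    refine tendsto_lintegral_of_dominated_convergence' (fun x => ‖B x‖ₑ ^ (2 : ℝ))
      (fun n => (hf n).enorm.pow_const _) (fun n => ?_) ?_ ?_
    · filter_upwards [hfB n] with x hx
      refine ENNReal.rpow_le_rpow (enorm_le_iff_norm_le.2 (hx.trans (le_abs_self _))) (by norm_num)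
    · simpa using (lintegral_rpow_enorm_lt_top_of_eLpNorm_lt_top (by norm_num) (by norm_num) hB.2).ne
    · filter_upwards [hlim] with x hx
      have := (ENNReal.continuous_rpow_const (y := (2 : ℝ))).continuousAt.tendsto.comp hx.enorm
      simpa [Function.comp_def] using this
  have h2 := (ENNReal.continuous_rpow_const (y := (1 / 2 : ℝ))).continuousAt.tendsto.comp key
  simpa [eLpNorm_eq_lintegral_rpow_enorm_toReal, Function.comp_def] using h2

/-- The chain rule in `W^{1,2}_0` for smooth functions with derivative bounded by one. -/
lemma MemW12Zero.comp_smooth (hΩ : Bornology.IsBounded Ω) (hu : MemW12Zero Ω u Du) {G : ℝ → ℝ}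
    (hG : ContDiff ℝ ∞ G) (hG0 : G 0 = 0) (hG1 : ∀ t, |deriv G t| ≤ 1) :
    MemW12Zero Ω (fun x => G (u x)) (fun x => deriv G (u x) • Du x) := by
  obtain ⟨ψ, hψ, l1, l2⟩ := hu.exists_approx
  have hum := hu.memW12.memLp
  have hDum := hu.memW12.memLp_grad
  have hdiff : Differentiable ℝ G := hG.differentiable (by simp)
  have hdc : Continuous (deriv G) := hG.continuous_deriv (by simp)
  have hlip : ∀ s t, ‖G s - G t‖ ≤ ‖s - t‖ := fun s t => by
    simpa using Convex.norm_image_sub_le_of_norm_deriv_le (f := G) (C := 1) (s := Set.univ)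
      (fun x _ => hdiff x) (fun x _ => hG1 x) convex_univ (Set.mem_univ t) (Set.mem_univ s)
  -- Pointwise a.e. convergence, needed for `deriv G (ψ n)`, is available only along a subsequence.
  obtain ⟨ns, hns, hae⟩ := (tendstoInMeasure_of_tendsto_eLpNorm (by norm_num)
    (fun n => ((hψ n).memLp 2).1) hum.1 l1).exists_seq_tendsto_ae
  have hGu : MemLp (fun x => G (u x)) 2 (volume.restrict Ω) :=
    hum.of_le (hG.continuous.comp_aestronglyMeasurable hum.1)
      (.of_forall fun x => by simpa [hG0] using hlip (u x) 0)
  have hDGm : ∀ {a : EuclideanSpace ℝ (Fin N) → ℝ}, AEStronglyMeasurable a (volume.restrict Ω) →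
      AEStronglyMeasurable (fun x => deriv G (a x)) (volume.restrict Ω) := fun ha =>
    hdc.comp_aestronglyMeasurable ha
  have hsm : ∀ (t : ℝ) (e : EuclideanSpace ℝ (Fin N)), ‖deriv G t • e‖ ≤ ‖e‖ := fun t e => by
    rw [norm_smul]
    exact mul_le_of_le_one_left (norm_nonneg _) (hG1 t)
  have hGDu : MemLp (fun x => deriv G (u x) • Du x) 2 (volume.restrict Ω) :=
    hDum.of_le ((hDGm hum.1).smul hDum.1) (.of_forall fun x => hsm _ _)
  refine memW12Zero_of_tendsto_isTestFunction hΩ hGu hGDu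
    (fun n => (hψ (ns n)).comp hG hG0) ?_ ?_
  · refine tendsto_of_tendsto_of_tendsto_of_le_of_le tendsto_const_nhds
      (l1.comp hns.tendsto_atTop) (fun _ => zero_le) fun n => ?_
    exact eLpNorm_mono fun x => hlip _ _
  · have l3 : Tendsto (fun n => eLpNorm
        (fun x => (deriv G (ψ (ns n) x) - deriv G (u x)) • Du x) 2 (volume.restrict Ω))
        atTop (𝓝 0) := by
      refine tendsto_eLpNorm_two_zero_of_dominated (B := fun x => 2 * ‖Du x‖)
        (hDum.norm.const_mul 2)
        (fun n => ((hDGm ((hψ _).memLp 2).1).sub (hDGm hum.1)).smul hDum.1)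
        (fun n => .of_forall fun x => ?_) ?_
      · rw [norm_smul]
        refine mul_le_mul_of_nonneg_right ?_ (norm_nonneg _)
        refine (norm_sub_le _ _).trans ?_
        simp only [Real.norm_eq_abs]
        linarith [hG1 (ψ (ns n) x), hG1 (u x)]
      · filter_upwards [hae] with x hx
        have := ((hdc.tendsto (u x)).comp hx).sub_const (deriv G (u x))
        simpa using this.smul_const (Du x)
    refine tendsto_of_tendsto_of_tendsto_of_le_of_le tendsto_const_nhds
      (by simpa using (l2.comp hns.tendsto_atTop).add l3) (fun _ => zero_le) fun n => ?_
    -- The first term is controlled by `|deriv G| ≤ 1` and gradient convergence, the second by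
    -- dominated convergence (`l3`).
    have heq : (fun x => gradient (fun x => G (ψ (ns n) x)) x - deriv G (u x) • Du x)
        = (fun x => deriv G (ψ (ns n) x) • (gradient (ψ (ns n)) x - Du x))
          + fun x => (deriv G (ψ (ns n) x) - deriv G (u x)) • Du x := by
      ext1 x
      simp only [Pi.add_apply, gradient_comp_of_isTestFunction (hψ (ns n)) hdiff, smul_sub,
        sub_smul]
      abel
    rw [heq]
    refine (eLpNorm_add_le
      ((hDGm ((hψ _).memLp 2).1).smul (((hψ _).memLp_gradient 2).sub hDum).1)
      (((hDGm ((hψ _).memLp 2).1).sub (hDGm hum.1)).smul hDum.1) (by norm_num)).trans ?_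
    exact add_le_add_left (eLpNorm_mono fun x => hsm _ _) _

/-- The chain rule in `W^{1,2}_0` for primitives of pointwise limits of smooth functions with
values in `[-1, 1]`. -/
lemma MemW12Zero.comp_primitive (hΩ : Bornology.IsBounded Ω) (hu : MemW12Zero Ω u Du)
    {g : ℕ → ℝ → ℝ} {g₀ : ℝ → ℝ} (hg : ∀ n, ContDiff ℝ ∞ (g n)) (hg1 : ∀ n t, |g n t| ≤ 1)
    (hlim : ∀ t, Tendsto (fun n => g n t) atTop (𝓝 (g₀ t))) :
    MemW12Zero Ω (fun x => ∫ t in (0 : ℝ)..u x, g₀ t) (fun x => g₀ (u x) • Du x) := by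
  have hum := hu.memW12.memLp
  have hDum := hu.memW12.memLp_grad
  have hder : ∀ n t, HasDerivAt (fun t => ∫ s in (0 : ℝ)..t, g n s) (g n t) t := fun n t =>
    (hg n).continuous.integral_hasStrictDerivAt 0 t |>.hasDerivAt
  have hderiv : ∀ n, deriv (fun t => ∫ s in (0 : ℝ)..t, g n s) = g n := fun n =>
    funext fun t => (hder n t).deriv
  have hmem : ∀ n, MemW12Zero Ω (fun x => ∫ t in (0 : ℝ)..u x, g n t)
      (fun x => g n (u x) • Du x) := fun n => by
    have := hu.comp_smooth hΩ (G := fun t => ∫ s in (0 : ℝ)..t, g n s)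
      (contDiff_infty_iff_deriv.2 ⟨fun t => (hder n t).differentiableAt, by
        rw [hderiv]; exact hg n⟩) (by simp) (by rw [hderiv]; exact hg1 n)
    rwa [hderiv] at this
  have hg₀1 : ∀ t, |g₀ t| ≤ 1 := fun t =>
    le_of_tendsto (hlim t).abs (.of_forall fun n => hg1 n t)
  have hlimG : ∀ r : ℝ, Tendsto (fun n => ∫ t in (0 : ℝ)..r, g n t) atTop
      (𝓝 (∫ t in (0 : ℝ)..r, g₀ t)) := fun r =>
    intervalIntegral.tendsto_integral_filter_of_dominated_convergence (fun _ => 1)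
      (.of_forall fun n => (hg n).continuous.aestronglyMeasurable)
      (.of_forall fun n => .of_forall fun t _ => hg1 n t) (by simp)
      (.of_forall fun t _ => hlim t)
  have hbd : ∀ (k : ℝ → ℝ), (∀ t, |k t| ≤ 1) → ∀ r : ℝ, ‖∫ t in (0 : ℝ)..r, k t‖ ≤ ‖r‖ :=
    fun k hk r => by
      simpa using intervalIntegral.norm_integral_le_of_norm_le_const (a := 0) (b := r) (f := k)
        (C := 1) (fun t _ => hk t)
  have hsm : ∀ (k : ℝ → ℝ), (∀ t, |k t| ≤ 1) → ∀ (t : ℝ) (e : EuclideanSpace ℝ (Fin N)),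
      ‖k t • e‖ ≤ ‖e‖ := fun k hk t e => by
    rw [norm_smul]
    exact mul_le_of_le_one_left (norm_nonneg _) (hk t)
  -- Measurability is inherited from the approximations as pointwise limits.
  have hm1 : AEStronglyMeasurable (fun x => ∫ t in (0 : ℝ)..u x, g₀ t) (volume.restrict Ω) :=
    aestronglyMeasurable_of_tendsto_ae atTop (fun n => (hmem n).memW12.memLp.1)
      (.of_forall fun x => hlimG (u x))
  have hm2 : AEStronglyMeasurable (fun x => g₀ (u x) • Du x) (volume.restrict Ω) :=
    aestronglyMeasurable_of_tendsto_ae atTop (fun n => (hmem n).memW12.memLp_grad.1)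
      (.of_forall fun x => (hlim (u x)).smul_const (Du x))
  refine MemW12Zero.of_tendsto hΩ (hum.of_le hm1 (.of_forall fun x => hbd _ hg₀1 _))
    (hDum.of_le hm2 (.of_forall fun x => hsm _ hg₀1 _ _)) hmem ?_ ?_
  · refine tendsto_eLpNorm_two_zero_of_dominated (B := fun x => 2 * ‖u x‖) (hum.norm.const_mul 2)
      (fun n => (hmem n).memW12.memLp.1.sub hm1) (fun n => .of_forall fun x => ?_)
      (.of_forall fun x => ?_)
    · exact (norm_sub_le _ _).trans (by linarith [hbd _ (hg1 n) (u x), hbd _ hg₀1 (u x)])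
    · simpa using (hlimG (u x)).sub_const (∫ t in (0 : ℝ)..u x, g₀ t)
  · refine tendsto_eLpNorm_two_zero_of_dominated (B := fun x => 2 * ‖Du x‖)
      (hDum.norm.const_mul 2)
      (fun n => (hmem n).memW12.memLp_grad.1.sub hm2) (fun n => .of_forall fun x => ?_)
      (.of_forall fun x => ?_)
    · exact (norm_sub_le _ _).trans
        (by linarith [hsm _ (hg1 n) (u x) (Du x), hsm _ hg₀1 (u x) (Du x)])
    · simpa using ((hlim (u x)).smul_const (Du x)).sub_const (g₀ (u x) • Du x)

/-- Convergence at every point, endpoints included, makes it unnecessary to know that `Du` vanishes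
a.e. on level sets of `u`. The shift `+ 1` keeps the second factor equal to one up to and including
`t = ε`. -/
lemma exists_smooth_tendsto_indicator_Ioc (ε : ℝ) : ∃ g : ℕ → ℝ → ℝ, (∀ n, ContDiff ℝ ∞ (g n)) ∧
    (∀ n t, |g n t| ≤ 1) ∧
    ∀ t, Tendsto (fun n => g n t) atTop (𝓝 ((Set.Ioc 0 ε).indicator (fun _ => (1 : ℝ)) t)) := by
  refine ⟨fun n t => Real.smoothTransition (n * t) * Real.smoothTransition (n * (ε - t) + 1),
    fun n => ?_, fun n t => ?_, fun t => ?_⟩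
  · exact (Real.smoothTransition.contDiff.comp (by fun_prop)).mul
      (Real.smoothTransition.contDiff.comp (by fun_prop))
  · rw [abs_of_nonneg (mul_nonneg (Real.smoothTransition.nonneg _) (Real.smoothTransition.nonneg _))]
    exact mul_le_one₀ (Real.smoothTransition.le_one _) (Real.smoothTransition.nonneg _)
      (Real.smoothTransition.le_one _)
  · refine tendsto_const_nhds.congr' ?_
    rcases le_or_gt t 0 with ht | ht
    · refine .of_forall fun n => ?_
      beta_reduce
      rw [Real.smoothTransition.zero_of_nonpos (mul_nonpos_of_nonneg_of_nonpos n.cast_nonneg ht)]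
      simp [ht.not_gt]
    rcases le_or_gt t ε with hε | hε
    · filter_upwards [(tendsto_natCast_atTop_atTop.atTop_mul_const ht).eventually_ge_atTop 1]
        with n hn
      rw [Real.smoothTransition.one_of_one_le hn, Real.smoothTransition.one_of_one_le
        (le_add_of_nonneg_left (mul_nonneg n.cast_nonneg (sub_nonneg.2 hε)))]
      simp [ht, hε]
    · filter_upwards [(tendsto_natCast_atTop_atTop.atTop_mul_const
        (sub_pos.2 hε)).eventually_ge_atTop 1] with n hn
      rw [Real.smoothTransition.zero_of_nonpos (x := n * (ε - t) + 1) (by linarith)]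
      simp [hε.not_ge]

lemma integral_indicator_Ioc_eq {ε : ℝ} (hε : 0 ≤ ε) (r : ℝ) :
    ∫ t in (0 : ℝ)..r, (Set.Ioc 0 ε).indicator (fun _ => (1 : ℝ)) t = max 0 (min r ε) := by
  rcases le_total 0 r with hr | hr
  · rw [intervalIntegral.integral_of_le hr, setIntegral_indicator measurableSet_Ioc,
      Set.Ioc_inter_Ioc]
    simp [hr, hε]
  · rw [intervalIntegral.integral_of_ge hr, setIntegral_indicator measurableSet_Ioc,
      Set.Ioc_inter_Ioc]
    simp [hr, hε]

/-- Truncation of the positive part in `W^{1,2}_0`. -/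
lemma MemW12Zero.truncate (hΩ : Bornology.IsBounded Ω) (hu : MemW12Zero Ω u Du) {ε : ℝ}
    (hε : 0 ≤ ε) :
    MemW12Zero Ω (fun x => max 0 (min (u x) ε))
      (fun x => (Set.Ioc 0 ε).indicator (fun _ => (1 : ℝ)) (u x) • Du x) := by
  obtain ⟨g, hg, hg1, hlim⟩ := exists_smooth_tendsto_indicator_Ioc ε
  simpa only [integral_indicator_Ioc_eq hε] using hu.comp_primitive hΩ hg hg1 hlim

end ChainRule

/-! ### Poincaré inequality, energy estimate and comparison. -/

section Comparison

variable {N : ℕ} {Ω : Set (EuclideanSpace ℝ (Fin N))}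

/-- The Poincaré inequality in `W^{1,2}_0(Ω)` for bounded `Ω`. -/
lemma exists_eLpNorm_le_mul_eLpNorm_grad (hN : 2 < N) (hΩ : Bornology.IsBounded Ω) :
    ∃ C : NNReal, ∀ u Du, MemW12Zero Ω u Du →
      eLpNorm u 2 (volume.restrict Ω) ≤ C * eLpNorm Du 2 (volume.restrict Ω) := by
  refine ⟨eLpNormLESNormFDerivOfLeConst ℝ volume Ω 2 2, fun u Du hu => ?_⟩
  set C := eLpNormLESNormFDerivOfLeConst ℝ (volume : Measure (EuclideanSpace ℝ (Fin N))) Ω 2 2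
  have htest : ∀ {ψ}, IsTestFunction Ω ψ → eLpNorm ψ 2 (volume.restrict Ω)
      ≤ C * eLpNorm (gradient ψ) 2 (volume.restrict Ω) := by
    intro ψ hψ
    have hsupp : Function.support (gradient ψ) ⊆ Ω := fun x hx => by
      refine hψ.2.2 (support_fderiv_subset ℝ (f := ψ) ?_)
      rw [Function.mem_support, ← norm_ne_zero_iff, ← norm_gradient] at *
      exact hx
    rw [eLpNorm_restrict_eq_of_support_subset hsupp, eLpNorm_congr_norm_ae (g := fderiv ℝ ψ)
      (.of_forall (norm_gradient ψ))]
    refine (eLpNorm_restrict_le _ _ _ _).trans ?_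
    -- Gagliardo–Nirenberg–Sobolev on a bounded set with both exponents 2; this is where `2 < N`
    -- enters.
    exact eLpNorm_le_eLpNorm_fderiv volume (p := 2) (hψ.1.of_le (by simp))
      ((subset_tsupport ψ).trans hψ.2.2) (by norm_num) (by simpa using mod_cast hN) hΩ
  obtain ⟨ψ, hψ, l1, l2⟩ := hu.exists_approx
  have hum := hu.memW12.memLp
  have hDum := hu.memW12.memLp_grad
  have hlim : Tendsto (fun n => eLpNorm (fun x => ψ n x - u x) 2 (volume.restrict Ω)
      + C * (eLpNorm (fun x => gradient (ψ n) x - Du x) 2 (volume.restrict Ω)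
        + eLpNorm Du 2 (volume.restrict Ω))) atTop
      (𝓝 (C * eLpNorm Du 2 (volume.restrict Ω))) := by
    simpa using l1.add (ENNReal.Tendsto.const_mul (l2.add_const (eLpNorm Du 2 (volume.restrict Ω)))
      (.inr (ENNReal.coe_ne_top (r := C))))
  refine ge_of_tendsto' hlim fun n => ?_
  have h1 : eLpNorm u 2 (volume.restrict Ω) ≤ eLpNorm (fun x => ψ n x - u x) 2 (volume.restrict Ω)
      + eLpNorm (ψ n) 2 (volume.restrict Ω) := by
    have := eLpNorm_sub_le (p := 2) ((hψ n).memLp 2).1 (((hψ n).memLp 2).sub hum).1 (by norm_num)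
    rw [sub_sub_cancel, add_comm] at this
    exact this
  have h2 : eLpNorm (gradient (ψ n)) 2 (volume.restrict Ω)
      ≤ eLpNorm (fun x => gradient (ψ n) x - Du x) 2 (volume.restrict Ω)
        + eLpNorm Du 2 (volume.restrict Ω) := by
    have := eLpNorm_add_le (p := 2) (((hψ n).memLp_gradient 2).sub hDum).1 hDum.1 (by norm_num)
    rw [sub_add_cancel] at this
    exact this
  exact h1.trans (add_le_add_right ((htest (hψ n)).trans (by gcongr)) _)

lemma ofReal_integral_norm_sq_eq_eLpNorm_sq {X F : Type*} [MeasurableSpace X] {ν : Measure X}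
    [NormedAddCommGroup F] {f : X → F} (hf : MemLp f 2 ν) :
    ENNReal.ofReal (∫ x, ‖f x‖ ^ 2 ∂ν) = eLpNorm f 2 ν ^ 2 := by
  rw [ofReal_integral_eq_lintegral_ofReal (by simpa using hf.integrable_norm_pow (by norm_num))
    (.of_forall fun x => by positivity)]
  have := eLpNorm_nnreal_pow_eq_lintegral (μ := ν) (f := f) (p := 2) (by norm_num)
  simp only [NNReal.coe_ofNat, ENNReal.rpow_ofNat] at this
  rw [show ((2 : NNReal) : ℝ≥0∞) = 2 by rfl] at this
  rw [this]
  simp [ENNReal.ofReal_pow]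

lemma exists_integral_sq_le_mul_integral_norm_grad_sq (hN : 2 < N) (hΩ : Bornology.IsBounded Ω) :
    ∃ C : ℝ, 0 ≤ C ∧ ∀ u Du, MemW12Zero Ω u Du →
      ∫ x in Ω, u x ^ 2 ≤ C * ∫ x in Ω, ‖Du x‖ ^ 2 := by
  obtain ⟨C, hC⟩ := exists_eLpNorm_le_mul_eLpNorm_grad hN hΩ
  refine ⟨(C : ℝ) ^ 2, by positivity, fun u Du hu => ?_⟩
  have h := pow_le_pow_left₀ zero_le (hC u Du hu) 2
  rw [mul_pow, ← ofReal_integral_norm_sq_eq_eLpNorm_sq hu.memW12.memLp,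
    ← ofReal_integral_norm_sq_eq_eLpNorm_sq hu.memW12.memLp_grad, ← ENNReal.ofReal_coe_nnreal,
    ← ENNReal.ofReal_pow (by positivity), ← ENNReal.ofReal_mul (by positivity),
    ENNReal.ofReal_le_ofReal_iff (by positivity)] at h
  simpa using h

variable {M : EuclideanSpace ℝ (Fin N) → Matrix (Fin N) (Fin N) ℝ} {α β μ : ℝ} {h : ℝ → ℝ}
  {E : EuclideanSpace ℝ (Fin N) → EuclideanSpace ℝ (Fin N)}
  {f v w g : EuclideanSpace ℝ (Fin N) → ℝ}

/-- Pointwise form of the energy estimate on the strip `{0 < v - w ≤ ε}`. -/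
lemma mul_norm_sq_le_of_elliptic {A : EuclideanSpace ℝ (Fin N) →ₗ[ℝ] EuclideanSpace ℝ (Fin N)}
    (hα : 0 < α) (hA : ∀ ξ, α * ‖ξ‖ ^ 2 ≤ ⟪A ξ, ξ⟫) (hμ : 0 ≤ μ) {ε a b p q k : ℝ}
    {e ξ ζ : EuclideanSpace ℝ (Fin N)} (hlip : |p - q| * ‖e‖ ≤ |a - b| * k)
    {χ φ : ℝ} (hχ : χ = (Set.Ioc 0 ε).indicator (fun _ => (1 : ℝ)) (a - b))
    (hφ : φ = max 0 (min (a - b) ε)) :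
    α / 2 * ‖χ • (ξ - ζ)‖ ^ 2 - ε ^ 2 / (2 * α) * (χ * k ^ 2) ≤
      (⟪A ξ, χ • (ξ - ζ)⟫ + μ * a * φ - ⟪p • e, χ • (ξ - ζ)⟫)
        - (⟪A ζ, χ • (ξ - ζ)⟫ + μ * b * φ - ⟪q • e, χ • (ξ - ζ)⟫) := by
  have hφ0 : 0 ≤ μ * ((a - b) * φ) := by
    refine mul_nonneg hμ ?_
    rw [hφ]
    rcases le_total 0 (a - b) with h0 | h0
    · exact mul_nonneg h0 (le_max_left _ _)
    · simp [h0]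
  by_cases hs : a - b ∈ Set.Ioc 0 ε
  · have h1 : χ = 1 := by simp only [hχ, Set.indicator_of_mem hs]
    simp only [h1, one_smul, one_mul]
    have h2 := hA (ξ - ζ)
    rw [map_sub, inner_sub_left] at h2
    have h3 : ⟪p • e, ξ - ζ⟫ - ⟪q • e, ξ - ζ⟫ ≤ ε * k * ‖ξ - ζ‖ := by
      rw [← inner_sub_left, ← sub_smul]
      refine (real_inner_le_norm _ _).trans (mul_le_mul_of_nonneg_right ?_ (norm_nonneg _))
      rw [norm_smul, Real.norm_eq_abs]
      rw [abs_of_pos hs.1] at hlip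
      -- The sign of `k` is forced by `hlip`, since `a - b > 0` on the strip.
      have hk : 0 ≤ k := by
        by_contra! hk
        have := mul_neg_of_pos_of_neg hs.1 hk
        have : 0 ≤ |p - q| * ‖e‖ := by positivity
        linarith
      exact hlip.trans (mul_le_mul_of_nonneg_right hs.2 hk)
    -- Young's inequality, weighted so that half of the ellipticity survives.
    have h4 : ε * k * ‖ξ - ζ‖ ≤ α / 2 * ‖ξ - ζ‖ ^ 2 + ε ^ 2 / (2 * α) * k ^ 2 := by
      have : α / 2 * ‖ξ - ζ‖ ^ 2 + ε ^ 2 / (2 * α) * k ^ 2 - ε * k * ‖ξ - ζ‖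
          = (α * ‖ξ - ζ‖ - ε * k) ^ 2 / (2 * α) := by field_simp; ring
      have : 0 ≤ (α * ‖ξ - ζ‖ - ε * k) ^ 2 / (2 * α) := by positivity
      linarith
    linarith
  -- Off the strip the test gradient vanishes and only the nonnegative `μ` term remains.
  · have h1 : χ = 0 := by simp only [hχ, Set.indicator_of_notMem hs]
    simp only [h1, zero_smul, inner_zero_right, norm_zero, zero_mul]
    linarith

/-- The truncations of `(v - w)⁺` at height `ε` have energy `o(ε²)`. -/
lemma IsWeakSubsolution.exists_energy_estimate (hΩ : Bornology.IsBounded Ω) (hα : 0 < α)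
    (hM : IsElliptic Ω M α β) (hμ : 0 ≤ μ) (hg : MemLp g 2 (volume.restrict Ω))
    (hlip : ∀ᵐ x ∂(volume.restrict Ω), |h (v x) - h (w x)| * ‖E x‖ ≤ |v x - w x| * g x)
    (hv : IsWeakSubsolution Ω M μ h E f v) (hw : IsWeakSupersolution Ω M μ h E f w)
    {ε : ℝ} (hε : 0 ≤ ε) :
    ∃ Dφ, MemW12Zero Ω (fun x => max 0 (min (v x - w x) ε)) Dφ ∧
      ∫ x in Ω, ‖Dφ x‖ ^ 2 ≤ ε ^ 2 / α ^ 2 *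
        ∫ x in Ω, (Set.Ioc 0 ε).indicator (fun _ => (1 : ℝ)) (v x - w x) * g x ^ 2 := by
  obtain ⟨Dv, hDv, Hv⟩ := hv
  obtain ⟨Dw, hDw, Hw⟩ := hw
  set χ : EuclideanSpace ℝ (Fin N) → ℝ := fun x =>
    (Set.Ioc 0 ε).indicator (fun _ => (1 : ℝ)) (v x - w x) with hχ
  set φ : EuclideanSpace ℝ (Fin N) → ℝ := fun x => max 0 (min (v x - w x) ε) with hφ
  have hd : MemW12Zero Ω φ (fun x => χ x • (Dv x - Dw x)) := (hDv.sub hΩ hDw).truncate hΩ hε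
  have hφtop : MemLp φ ∞ (volume.restrict Ω) :=
    memLp_top_of_bound hd.memW12.memLp.1 ε (.of_forall fun x => by
      rw [Real.norm_eq_abs, abs_of_nonneg (le_max_left _ _)]
      exact max_le hε (min_le_right _ _))
  have hφ0 : ∀ᵐ x ∂(volume.restrict Ω), 0 ≤ φ x := .of_forall fun x => le_max_left _ _
  obtain ⟨iv, jv, ineqv⟩ := Hv _ _ hd hφtop hφ0
  obtain ⟨iw, jw, ineqw⟩ := Hw _ _ hd hφtop hφ0
  have kv : IntegrableOn (fun x => μ * v x * φ x) Ω :=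
    (hDv.memW12.memLp.const_mul μ).integrable_mul hd.memW12.memLp
  have kw : IntegrableOn (fun x => μ * w x * φ x) Ω :=
    (hDw.memW12.memLp.const_mul μ).integrable_mul hd.memW12.memLp
  refine ⟨_, hd, ?_⟩
  have id : IntegrableOn (fun x => ‖χ x • (Dv x - Dw x)‖ ^ 2) Ω := by
    exact hd.memW12.memLp_grad.integrable_norm_pow (p := 2) (by norm_num)
  have hχm : AEStronglyMeasurable χ (volume.restrict Ω) :=
    ((measurable_const.indicator measurableSet_Ioc).comp_aemeasurable
      (hDv.memW12.memLp.sub hDw.memW12.memLp).1.aemeasurable).aestronglyMeasurable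
  have ig : IntegrableOn (fun x => χ x * g x ^ 2) Ω := by
    refine Integrable.bdd_mul (c := 1) (by simpa using hg.integrable_sq) hχm (.of_forall fun x => ?_)
    by_cases hs : v x - w x ∈ Set.Ioc 0 ε
    · simp only [hχ, Set.indicator_of_mem hs, norm_one, le_refl]
    · simp only [hχ, Set.indicator_of_notMem hs, norm_zero, zero_le_one]
  have hmono := integral_mono_ae ((id.const_mul (α / 2)).sub (ig.const_mul (ε ^ 2 / (2 * α))))
    (((iv.add kv).sub jv).sub ((iw.add kw).sub jw)) (by
      filter_upwards [hM.bounds, hlip] with x hMx hlx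
      exact mul_norm_sq_le_of_elliptic hα (fun ξ => (hMx ξ).1) hμ hlx rfl rfl)
  rw [integral_sub' (id.const_mul (α / 2)) (ig.const_mul (ε ^ 2 / (2 * α))),
    integral_sub' ((iv.add kv).sub jv) ((iw.add kw).sub jw), integral_sub' (iv.add kv) jv,
    integral_sub' (iw.add kw) jw, integral_add' iv kv, integral_add' iw kw,
    integral_const_mul, integral_const_mul] at hmono
  -- The bracket for `v` integrates to at most `∫ f φ`, the bracket for `w` to at least `∫ f φ`, so
  -- their difference is nonpositive.
  have hfin : α / 2 * ∫ x in Ω, ‖χ x • (Dv x - Dw x)‖ ^ 2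
      ≤ ε ^ 2 / (2 * α) * ∫ x in Ω, χ x * g x ^ 2 := by linarith
  calc ∫ x in Ω, ‖χ x • (Dv x - Dw x)‖ ^ 2
      = 2 / α * (α / 2 * ∫ x in Ω, ‖χ x • (Dv x - Dw x)‖ ^ 2) := by field_simp
    _ ≤ 2 / α * (ε ^ 2 / (2 * α) * ∫ x in Ω, χ x * g x ^ 2) := by gcongr
    _ = ε ^ 2 / α ^ 2 * ∫ x in Ω, χ x * g x ^ 2 := by field_simp

/-- Comparison under a Lipschitz bound with an `L²` weight. -/
theorem IsWeakSubsolution.ae_le (hN : 2 < N) (hΩ : Bornology.IsBounded Ω) (hα : 0 < α)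
    (hM : IsElliptic Ω M α β) (hμ : 0 ≤ μ) (hg : MemLp g 2 (volume.restrict Ω))
    (hlip : ∀ᵐ x ∂(volume.restrict Ω), |h (v x) - h (w x)| * ‖E x‖ ≤ |v x - w x| * g x)
    (hv : IsWeakSubsolution Ω M μ h E f v) (hw : IsWeakSupersolution Ω M μ h E f w) :
    ∀ᵐ x ∂(volume.restrict Ω), v x ≤ w x := by
  have : IsFiniteMeasure (volume.restrict Ω) := ⟨by simpa using hΩ.measure_lt_top⟩
  have hdm : AEMeasurable (fun x => v x - w x) (volume.restrict Ω) := by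
    obtain ⟨Dv, hDv, -⟩ := hv
    obtain ⟨Dw, hDw, -⟩ := hw
    exact (hDv.memW12.memLp.sub hDw.memW12.memLp).1.aemeasurable
  obtain ⟨C, hC0, hC⟩ := exists_integral_sq_le_mul_integral_norm_grad_sq hN hΩ
  set I : ℝ → ℝ := fun ε =>
    ∫ x in Ω, (Set.Ioc 0 ε).indicator (fun _ => (1 : ℝ)) (v x - w x) * g x ^ 2
  -- On `{v - w ≥ δ}` the truncation equals `ε`, so Chebyshev produces `ε²`, matching the factor in
  -- the energy estimate.
  have hbound : ∀ {ε δ : ℝ}, 0 < ε → ε ≤ δ →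
      (volume.restrict Ω).real {x | δ ≤ v x - w x} ≤ C / α ^ 2 * I ε := by
    intro ε δ hε hεδ
    obtain ⟨Dφ, hφ, hen⟩ := hv.exists_energy_estimate hΩ hα hM hμ hg hlip hw hε.le
    have hcheb := mul_meas_ge_le_integral_of_nonneg (μ := volume.restrict Ω)
      (.of_forall fun x => sq_nonneg (max 0 (min (v x - w x) ε)))
      hφ.memW12.memLp.integrable_sq (ε ^ 2)
    have hsub : (volume.restrict Ω).real {x | δ ≤ v x - w x} ≤
        (volume.restrict Ω).real {x | ε ^ 2 ≤ max 0 (min (v x - w x) ε) ^ 2} := by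
      refine measureReal_mono fun x (hx : δ ≤ v x - w x) => ?_
      simp [min_eq_right (hεδ.trans hx), hε.le]
    have h1 : ε ^ 2 * (volume.restrict Ω).real {x | δ ≤ v x - w x}
        ≤ ε ^ 2 * (C / α ^ 2 * I ε) :=
      calc _ ≤ _ := mul_le_mul_of_nonneg_left hsub (sq_nonneg ε)
        _ ≤ _ := hcheb
        _ ≤ _ := hC _ _ hφ
        _ ≤ _ := mul_le_mul_of_nonneg_left hen hC0
        _ = _ := by ring
    exact le_of_mul_le_mul_left h1 (by positivity)
  have hI : Tendsto (fun n : ℕ => I (1 / ((n : ℝ) + 1))) atTop (𝓝 0) := by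
    have : Tendsto (fun n : ℕ => I (1 / ((n : ℝ) + 1))) atTop (𝓝 (∫ _ in Ω, (0 : ℝ))) := by
      refine tendsto_integral_of_dominated_convergence (fun x => g x ^ 2) (fun n => ?_)
        hg.integrable_sq (fun n => .of_forall fun x => ?_) (.of_forall fun x => ?_)
      · exact ((measurable_const.indicator measurableSet_Ioc).comp_aemeasurable
          hdm).aestronglyMeasurable.mul (hg.1.pow 2)
      · rw [norm_mul, Real.norm_of_nonneg (sq_nonneg (g x))]
        refine mul_le_of_le_one_left (sq_nonneg _) ((norm_indicator_le_norm_self _ _).trans ?_)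
        simp
      -- Each point lies outside the strip as soon as `ε < v x - w x`, or always if `v x ≤ w x`.
      · refine tendsto_const_nhds.congr' ?_
        rcases le_or_gt (v x - w x) 0 with hs | hs
        · exact .of_forall fun n => by simp [(sub_nonpos.1 hs).not_gt]
        · filter_upwards [tendsto_one_div_add_atTop_nhds_zero_nat.eventually_lt_const hs] with n hn
          rw [Set.indicator_of_notMem (fun hmem => (hn.trans_le hmem.2).false), zero_mul]
    simpa using this
  have hzero : ∀ n : ℕ, ∀ᵐ x ∂(volume.restrict Ω), v x - w x < 1 / ((n : ℝ) + 1) := by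
    intro n
    have hle : (volume.restrict Ω).real {x | 1 / ((n : ℝ) + 1) ≤ v x - w x} ≤ 0 := by
      have hlim := hI.const_mul (C / α ^ 2)
      rw [mul_zero] at hlim
      -- The level `1 / (n + 1)` stays fixed while the truncation height `1 / (k + 1)` tends to
      -- zero.
      refine ge_of_tendsto hlim ?_
      filter_upwards [eventually_ge_atTop n] with k hk
      exact hbound (by positivity) (Nat.one_div_le_one_div hk)
    have h0 := le_antisymm hle measureReal_nonneg
    rw [measureReal_eq_zero_iff] at h0
    simpa [ae_iff] using h0
  filter_upwards [ae_all_iff.2 hzero] with x hx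
  exact sub_nonpos.1 (ge_of_tendsto' tendsto_one_div_add_atTop_nhds_zero_nat fun n => (hx n).le)

end Comparison

/-! ### Increments of the nonlinearity. -/

section Nonlinearity

/-- A locally Lipschitz function is absolutely continuous on compact intervals, hence the integral
of its derivative. Between `a` and `b` one has `|s| ≤ max |a| |b|`, so `|s|^θ ≤ |a|^θ + |b|^θ`. -/
lemma _root_.LocallyLipschitz.abs_sub_le_of_ae_abs_deriv_le {h : ℝ → ℝ} (hh : LocallyLipschitz h)
    {θ c : ℝ} (hθ : 0 < θ) (hc : ∀ᵐ s : ℝ, |deriv h s| ≤ c * (|s| ^ θ + 1)) (a b : ℝ) :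
    |h a - h b| ≤ |c| * (|a| ^ θ + |b| ^ θ + 1) * |a - b| := by
  obtain ⟨K, hK⟩ := hh.locallyLipschitzOn.exists_lipschitzOnWith_of_compact
    (isCompact_uIcc (a := b) (b := a))
  rw [← hK.absolutelyContinuousOnInterval.integral_deriv_eq_sub, ← Real.norm_eq_abs]
  refine intervalIntegral.norm_integral_le_of_norm_le_const_ae ?_
  filter_upwards [hc] with s hs hmem
  refine hs.trans ((mul_le_mul_of_nonneg_right (le_abs_self c) (by positivity)).trans ?_)
  gcongr
  have hmax : |s| ≤ max |b| |a| := by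
    rcases Set.mem_uIoc.1 hmem with ⟨h1, h2⟩ | ⟨h1, h2⟩
    · exact abs_le_max_abs_abs h1.le h2
    · exact max_comm |a| |b| ▸ abs_le_max_abs_abs h1.le h2
  rcases le_max_iff.1 hmax with hle | hle
  · exact (Real.rpow_le_rpow (abs_nonneg s) hle hθ.le).trans (le_add_of_nonneg_left (by positivity))
  · exact (Real.rpow_le_rpow (abs_nonneg s) hle hθ.le).trans (le_add_of_nonneg_right (by positivity))

end Nonlinearity

/-! ### Choice of the weight, and solutions as sub- and supersolutions. -/

section Solutions

variable {N : ℕ} {Ω : Set (EuclideanSpace ℝ (Fin N))}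
  {M : EuclideanSpace ℝ (Fin N) → Matrix (Fin N) (Fin N) ℝ} {α β μ : ℝ} {h : ℝ → ℝ}
  {E : EuclideanSpace ℝ (Fin N) → EuclideanSpace ℝ (Fin N)}
  {f u v w : EuclideanSpace ℝ (Fin N) → ℝ}

lemma integrable_inner_of_memLp {X F : Type*} [MeasurableSpace X] {ν : Measure X}
    [NormedAddCommGroup F] [InnerProductSpace ℝ F] {a b : X → F} (ha : MemLp a 2 ν)
    (hb : MemLp b 2 ν) : Integrable (fun x => ⟪a x, b x⟫) ν :=
  (ha.norm.integrable_mul hb.norm).mono' (ha.1.inner hb.1)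
    (.of_forall fun x => norm_inner_le_norm (𝕜 := ℝ) (a x) (b x))

/-- The integrability of the drift term, not part of the identity for solutions, follows from `h(u)E
∈ L²` by Cauchy–Schwarz. -/
lemma IsWeakSolution.isWeakSubsolution (hu : IsWeakSolution Ω M μ h E f u) :
    IsWeakSubsolution Ω M μ h E f u := by
  obtain ⟨Du, hDu, hE, H⟩ := hu
  exact ⟨Du, hDu, fun φ Dφ hφ _ _ => ⟨(H φ Dφ hφ).1,
    integrable_inner_of_memLp hE hφ.memW12.memLp_grad, (H φ Dφ hφ).2.le⟩⟩

lemma IsWeakSolution.isWeakSupersolution (hu : IsWeakSolution Ω M μ h E f u) :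
    IsWeakSupersolution Ω M μ h E f u := by
  obtain ⟨Du, hDu, hE, H⟩ := hu
  exact ⟨Du, hDu, fun φ Dφ hφ _ _ => ⟨(H φ Dφ hφ).1,
    integrable_inner_of_memLp hE hφ.memW12.memLp_grad, (H φ Dφ hφ).2.ge⟩⟩

/-- Comparison of bounded sub- and supersolutions. -/
theorem IsWeakSubsolution.ae_le_of_memLp_top (hN : 2 < N) (hΩ : Bornology.IsBounded Ω)
    (hα : 0 < α) (hM : IsElliptic Ω M α β) (hh : LocallyLipschitz h) (hμ : 0 ≤ μ)
    (hE : MemLp E 2 (volume.restrict Ω)) (hvb : MemLp v ∞ (volume.restrict Ω))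
    (hwb : MemLp w ∞ (volume.restrict Ω)) (hv : IsWeakSubsolution Ω M μ h E f v)
    (hw : IsWeakSupersolution Ω M μ h E f w) : ∀ᵐ x ∂(volume.restrict Ω), v x ≤ w x := by
  -- Almost all values of `v` and `w` lie in the compact ball of radius `R`, where `h` has a single
  -- Lipschitz constant `K`.
  set R : ℝ := max (lpNorm v ∞ (volume.restrict Ω)) (lpNorm w ∞ (volume.restrict Ω))
  obtain ⟨K, hK⟩ := hh.locallyLipschitzOn.exists_lipschitzOnWith_of_compact
    (isCompact_closedBall (0 : ℝ) R)
  refine hv.ae_le hN hΩ hα hM hμ (hE.norm.const_mul K) ?_ hw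
  filter_upwards [ae_le_lpNorm_exponent_top hvb, ae_le_lpNorm_exponent_top hwb]
    with x hvx hwx
  have := hK.dist_le_mul (v x) (mem_closedBall_zero_iff.2 (hvx.trans (le_max_left _ _)))
    (w x) (mem_closedBall_zero_iff.2 (hwx.trans (le_max_right _ _)))
  rw [Real.dist_eq, Real.dist_eq] at this
  calc _ ≤ K * |v x - w x| * ‖E x‖ := by gcongr
    _ = _ := by ring

/-- Comparison of possibly unbounded sub- and supersolutions, under a growth condition on `h'`. -/
theorem IsWeakSubsolution.ae_le_of_abs_deriv_le (hN : 2 < N) (hΩ : Bornology.IsBounded Ω)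
    (hα : 0 < α) (hM : IsElliptic Ω M α β) (hh : LocallyLipschitz h) (hμ : 0 ≤ μ)
    (hE : MemLp E 2 (volume.restrict Ω)) {θ c : ℝ} (hθ : 0 < θ)
    (hc : ∀ᵐ s : ℝ, |deriv h s| ≤ c * (|s| ^ θ + 1))
    (hvw : MemLp (fun x => |v x| ^ θ * ‖E x‖ + |w x| ^ θ * ‖E x‖) 2 (volume.restrict Ω))
    (hv : IsWeakSubsolution Ω M μ h E f v) (hw : IsWeakSupersolution Ω M μ h E f w) :
    ∀ᵐ x ∂(volume.restrict Ω), v x ≤ w x := by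
  refine hv.ae_le hN hΩ hα hM hμ ((hvw.add hE.norm).const_mul |c|) (.of_forall fun x => ?_) hw
  have := hh.abs_sub_le_of_ae_abs_deriv_le hθ hc (v x) (w x)
  calc _ ≤ |c| * (|v x| ^ θ + |w x| ^ θ + 1) * |v x - w x| * ‖E x‖ := by gcongr
    _ = _ := by simp only [Pi.add_apply]; ring

end Solutions

end DriftComparison

theorem theorem2p2 {N : ℕ} (hN : 2 < N)
    (Ω : Set (EuclideanSpace ℝ (Fin N))) (hΩ : IsOpen Ω) (hΩb : Bornology.IsBounded Ω)
    (M : EuclideanSpace ℝ (Fin N) → Matrix (Fin N) (Fin N) ℝ) (α β : ℝ) (hα : 0 < α) (hβ : 0 < β)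
    (hM : DriftComparison.IsElliptic Ω M α β)
    (h : ℝ → ℝ) (hh : DriftComparison.IsAdmissibleNonlinearity h)
    (μ : ℝ) (hμ : 0 ≤ μ)
    (f : EuclideanSpace ℝ (Fin N) → ℝ)
    (hf : MemLp f (ENNReal.ofReal (2 * (N : ℝ) / ((N : ℝ) + 2))) (volume.restrict Ω))
    (E : EuclideanSpace ℝ (Fin N) → EuclideanSpace ℝ (Fin N))
    (hE : MemLp E 2 (volume.restrict Ω)) :
    -- comparison of bounded sub- and supersolutions
    (∀ v w : EuclideanSpace ℝ (Fin N) → ℝ,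
      MemLp v ∞ (volume.restrict Ω) → MemLp w ∞ (volume.restrict Ω) →
      DriftComparison.IsWeakSubsolution Ω M μ h E f v →
      DriftComparison.IsWeakSupersolution Ω M μ h E f w →
      ∀ᵐ x ∂(volume.restrict Ω), v x ≤ w x) ∧
    -- comparison of possibly unbounded sub- and supersolutions
    (∀ θ c : ℝ, 0 < θ → (∀ᵐ s : ℝ, |deriv h s| ≤ c * (|s| ^ θ + 1)) →
      ∀ v w : EuclideanSpace ℝ (Fin N) → ℝ,
        MemLp (fun x => |v x| ^ θ * ‖E x‖ + |w x| ^ θ * ‖E x‖) 2 (volume.restrict Ω) →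
        DriftComparison.IsWeakSubsolution Ω M μ h E f v →
        DriftComparison.IsWeakSupersolution Ω M μ h E f w →
        ∀ᵐ x ∂(volume.restrict Ω), v x ≤ w x) ∧
    -- uniqueness of bounded weak solutions
    (∀ u₁ u₂ : EuclideanSpace ℝ (Fin N) → ℝ,
      MemLp u₁ ∞ (volume.restrict Ω) → MemLp u₂ ∞ (volume.restrict Ω) →
      DriftComparison.IsWeakSolution Ω M μ h E f u₁ →
      DriftComparison.IsWeakSolution Ω M μ h E f u₂ →
      ∀ᵐ x ∂(volume.restrict Ω), u₁ x = u₂ x) ∧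
    -- uniqueness of possibly unbounded weak solutions
    (∀ θ c : ℝ, 0 < θ → (∀ᵐ s : ℝ, |deriv h s| ≤ c * (|s| ^ θ + 1)) →
      ∀ u₁ u₂ : EuclideanSpace ℝ (Fin N) → ℝ,
        MemLp (fun x => |u₁ x| ^ θ * ‖E x‖ + |u₂ x| ^ θ * ‖E x‖) 2 (volume.restrict Ω) →
        DriftComparison.IsWeakSolution Ω M μ h E f u₁ →
        DriftComparison.IsWeakSolution Ω M μ h E f u₂ →
        ∀ᵐ x ∂(volume.restrict Ω), u₁ x = u₂ x) := by
  have hL := hh.locallyLipschitz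
  refine ⟨fun v w hvb hwb hv hw => hv.ae_le_of_memLp_top hN hΩb hα hM hL hμ hE hvb hwb hw,
    fun θ c hθ hc v w hvw hv hw => hv.ae_le_of_abs_deriv_le hN hΩb hα hM hL hμ hE hθ hc hvw hw,
    fun u₁ u₂ hb₁ hb₂ h₁ h₂ => ?_, fun θ c hθ hc u₁ u₂ hu h₁ h₂ => ?_⟩
  · filter_upwards [h₁.isWeakSubsolution.ae_le_of_memLp_top hN hΩb hα hM hL hμ hE hb₁ hb₂
      h₂.isWeakSupersolution, h₂.isWeakSubsolution.ae_le_of_memLp_top hN hΩb hα hM hL hμ hE hb₂ hb₁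
      h₁.isWeakSupersolution] with x hx hy using le_antisymm hx hy
  · filter_upwards [h₁.isWeakSubsolution.ae_le_of_abs_deriv_le hN hΩb hα hM hL hμ hE hθ hc hu
      h₂.isWeakSupersolution, h₂.isWeakSubsolution.ae_le_of_abs_deriv_le hN hΩb hα hM hL hμ hE hθ hc
      (by simpa only [add_comm] using hu) h₁.isWeakSupersolution] with x hx hy using le_antisymm hx hy
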